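/- **Setting.** Let $d\ge 2$, let $\mathcal E^d$ and $\vec{\mathcal E}^d$ be the sets of undirected and directed nearest-neighbour edges of $\mathbb Z^d$, and let $\mathbb P$ be a probability measure on $\Omega_1=[0,\infty)^{\mathcal E^d}$ (product Borel $\sigma$-algebra, coordinates $(t_e)$). For a finite lattice path $\gamma$ let $T(\gamma)$ be the sum of the weights along $\gamma$; let $T(x,y)=\inf_{\gamma:x\to y}T(\gamma)$ for $x,y\in\mathbb Z^d$, $T(x,y)=T(\lfloor x\rfloor,\lfloor y\rfloor)$ for $x,y\in\mathbb R^d$ (coordinatewise integer parts), and $T(x,H)=\inf_{z\in H}T(x,z)$ for $H\subset\mathbb R^d$. Let $g(x)=\lim_n T(0,nx)/n$ (limit in probability) and let $\mathcal B=\{x\in\mathbb R^d: g(x)\le 1\}$ be the limit shape. Assume that one of the following holds. * **A.** The $t_e$ are i.i.d. with a continuous (atomless) common distribution, and $\mathbb E\big[(\min_{i\le 2d}t_{e_i})^d\big]<\infty$, where $e_1,\dots,e_{2d}$ are the edges incident to the origin. * **B.** $\mathbb P$ is invariant and ergodic under the translations of $\mathbb Z^d$ and invariant under all symmetries of $\mathbb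 Z^d$; $\mathbb E\,t_e^{d+\epsilon}<\infty$ for some $\epsilon>0$; $\mathcal B$ is bounded; $\mathbb P(T(\gamma)=T(\gamma'))=0$ for all finite paths $\gamma,\gamma'$ with distinct edge sets; and for every edge $e$ and every $\lambda>0$ with $\mathbb P(t_e\ge\lambda)>0$ one has $\mathbb P(t_e\ge\lambda\mid (t_f)_{f\ne e})>0$ a.s. Let $\rho\in\mathbb R^d$ be such that $\{z: z\cdot\rho=1\}$ is a supporting hyperplane of $\mathcal B$ at some point of $\mathcal B$, and put $H_\rho(\alpha)=\{z\in\mathbb R^d:z\cdot\rho=\alpha\}$. A geodesic from $x\in\mathbb Z^d$ to $H_\rho(\alpha)$ is a lattice path from $x$ to $\lfloor z\rfloor$, for some $z\in H_\rho(\alpha)$, with passage time $T(x,H_\rho(\alpha))$. Let $B_\alpha(x,y)=T(x,H_\rho(\alpha))-T(y,H_\rho(\alpha))$, and let $\eta_\alpha(\langle x,y\rangle)=1$ if $\{x,y\}$ is in a geodesic from $x$ to $H_\rho(\alpha)$ and $\eta_\alpha(\langle x,y\rangle)=0$ otherwise. Let $\Omega_2=\mathbb R^{\mathbb Z^d\times\mathbb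 Z^d}$, $\Omega_3=\{0,1\}^{\vec{\mathcal E}^d}$, let $\mu_\alpha$ be the law of $((t_e),B_\alpha,\eta_\alpha)$ on $\Omega_1\times\Omega_2\times\Omega_3$ under $\mathbb P$, let $\mu_n^*=\frac1n\int_0^n\mu_\alpha\,d\alpha$, and let $\mu$ be any subsequential weak limit of $(\mu_n^*)_{n}$. Events in $\Omega_1\times\Omega_3$ are regarded as events of the full space by leaving the $\Omega_2$-coordinate free. A *graph-cylinder event* is a finite union of sets $U\times V$ with $U\subset\Omega_1$ Borel and $V=\{\eta(f_1)=a_1,\dots,\eta(f_m)=a_m\}\subset\Omega_3$ for directed edges $f_i$ and $a_i\in\{0,1\}$. For $e_0\in\mathcal E^d$, a Borel set $A\subset\Omega_1\times\Omega_3$ is *$e_0$-approximable* if there are graph-cylinder events $(A_n)$ with $\mu(A_n\,\Delta\,A)\to 0$ such that for each $n$ there is $\alpha_0$ for which the following holds: whenever $\alpha\ge\alpha_0$ and $(t_e),(t_e')\in\Omega_1$ satisfy $t'_{e_0}\ge t_{e_0}$ and $t'_e=t_e$ for $e\neq e_0$, then $((t_e),\eta_\alpha((t_e)))\in A_n$ implies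 $((t'_e),\eta_\alpha((t'_e)))\in A_n$. **Theorem.** Let $e_0\in\mathcal E^d$ and $\lambda\in[0,S)$, where $S=\sup\{x\ge 0:\mathbb P(t_{e_0}\ge x)>0\}\in[0,\infty]$ is the supremum of the support of the common distribution of the weights. For every $r>0$ there exists $s>0$ such that every $e_0$-approximable event $A$ with $\mu(A)\ge r$ satisfies $$\mu(A,\ t_{e_0}\ge\lambda)\ \ge\ s .$$ -/

import Mathlib

open MeasureTheory ProbabilityTheory Filter Topology
open scoped NNReal ENNReal BoundedContinuousFunction

noncomputable section

namespace FPP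

/-! ### The lattice and its passage times -/

/-- Vertices of `ℤ^d`. -/
abbrev Vertex (d : ℕ) : Type := Fin d → ℤ

/-- The nearest-neighbour graph on `ℤ^d`: vertices at `ℓ¹`-distance one are adjacent. -/
def lattice (d : ℕ) : SimpleGraph (Vertex d) where
  Adj x y := ∑ i, |x i - y i| = 1
  symm := ⟨fun x y h => by simpa only [abs_sub_comm] using h⟩
  loopless := ⟨fun x h => by simp at h⟩

/-- Undirected edges. -/
abbrev Edge (d : ℕ) : Type := (lattice d).edgeSet

/-- Directed edges `⟨x, y⟩`. -/
abbrev DirEdge (d : ℕ) : Type := (lattice d).Dart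

/-- `Ω₁ = [0,∞)^E`: edge-weight configurations `(t_e)`. -/
abbrev Weights (d : ℕ) : Type := Edge d → ℝ≥0

/-- `Ω₂ = ℝ^(ℤ^d × ℤ^d)`: Busemann increments. -/
abbrev Increments (d : ℕ) : Type := Vertex d × Vertex d → ℝ

/-- `Ω₃ = {0,1}^(directed edges)`: graph configurations, `true` standing for `1`. -/
abbrev GraphConfig (d : ℕ) : Type := DirEdge d → Bool

/-- The enlarged space `Ω₁ × Ω₂ × Ω₃`, with the product topology and product `σ`-algebra. -/
abbrev Extended (d : ℕ) : Type := Weights d × Increments d × GraphConfig d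

variable {d : ℕ}

/-- The passage time `T(γ)` of a lattice path: the sum of the weights along it, with multiplicity. -/
def pathTime (t : Weights d) {x y : Vertex d} (p : (lattice d).Walk x y) : ℝ≥0 :=
  (p.darts.map fun a => t ⟨a.edge, a.edge_mem⟩).sum

/-- `T(x,y)` for lattice points: the infimum of `T(γ)` over all lattice paths from `x` to `y`. -/
def vertexTime (t : Weights d) (x y : Vertex d) : ℝ≥0 :=
  ⨅ p : (lattice d).Walk x y, pathTime t p

/-- Coordinatewise integer part of a real point. -/
def floorPt (z : Fin d → ℝ) : Vertex d := fun i => ⌊z i⌋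

/-- `T(x,y) = T(⌊x⌋,⌊y⌋)` for real points. -/
def pointTime (t : Weights d) (x y : Fin d → ℝ) : ℝ≥0 :=
  vertexTime t (floorPt x) (floorPt y)

/-- The hyperplane `H_ρ(α) = {z : z · ρ = α}`. -/
def hyperplane (ρ : Fin d → ℝ) (α : ℝ) : Set (Fin d → ℝ) := {z | z ⬝ᵥ ρ = α}

/-- `T(x, H_ρ(α))`, the infimum over the real points of the hyperplane. -/
def planeTime (t : Weights d) (ρ : Fin d → ℝ) (α : ℝ) (x : Vertex d) : ℝ≥0 :=
  ⨅ z : hyperplane ρ α, vertexTime t x (floorPt z.1)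

/-- `p` is a geodesic from `x` to `H_ρ(α)`: it ends at (the integer part of) a point of the
hyperplane and attains the passage time `T(x, H_ρ(α))`. -/
def IsPlaneGeodesic (t : Weights d) (ρ : Fin d → ℝ) (α : ℝ) {x y : Vertex d}
    (p : (lattice d).Walk x y) : Prop :=
  (∃ z ∈ hyperplane ρ α, floorPt z = y) ∧ pathTime t p = planeTime t ρ α x

/-! ### Assumptions on the law `P` of the weights -/

/-- Assumption A: i.i.d. weights with a continuous common law, such that the `d`-th moment of the
minimum of the weights of the `2d` edges incident to the origin is finite. -/
structure AssumptionA (P : Measure (Weights d)) : Prop where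
  indep : iIndepFun (fun (e : Edge d) (t : Weights d) => t e) P
  identDistrib : ∀ e f : Edge d,
    P.map (fun t : Weights d => t e) = P.map (fun t : Weights d => t f)
  moment : ∫⁻ t : Weights d,
    ((⨅ e : {e : Edge d // (0 : Vertex d) ∈ e.1}, t e.1 : ℝ≥0) : ℝ≥0∞) ^ d ∂P < ∞
  continuous : ∀ (e : Edge d) (a : ℝ≥0), P {t | t e = a} = 0

/-- Action on weights of an automorphism of the lattice, `(t_e) ↦ (t_{φ(e)})`. -/
def moveWeights (φ : lattice d ≃g lattice d) (t : Weights d) : Weights d :=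
  fun e => t (φ.mapEdgeSet e)

/-- The translation `x ↦ x + z` of the lattice. -/
def translation (z : Vertex d) : lattice d ≃g lattice d where
  toEquiv := Equiv.addRight z
  map_rel_iff' := by intro x y; simp [lattice]

/-- `x` has time constant `c = g(x)`: `T(0,nx)/n → c` in probability. -/
def IsTimeConstant (P : Measure (Weights d)) (x : Fin d → ℝ) (c : ℝ) : Prop :=
  TendstoInMeasure P
    (fun (n : ℕ) (t : Weights d) => (pointTime t 0 ((n : ℝ) • x) : ℝ) / n) atTop (fun _ => c)

/-- The limit shape `{x : g(x) ≤ 1}`. -/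
def limitShape (P : Measure (Weights d)) : Set (Fin d → ℝ) :=
  {x | ∃ c : ℝ, IsTimeConstant P x c ∧ c ≤ 1}

/-- The `σ`-algebra generated by the weights `(t_f)_{f ≠ e}`. -/
abbrev sigmaOff (e : Edge d) : MeasurableSpace (Weights d) :=
  MeasurableSpace.comap (fun (t : Weights d) (f : {f : Edge d // f ≠ e}) => t f.1) inferInstance

/-- Assumption B: a translation-ergodic law with all the symmetries of `ℤ^d`, a moment of order
`d + ε`, a bounded limit shape, unique passage times, and upward finite energy. -/
structure AssumptionB (P : Measure (Weights d)) : Prop where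
  stationary : ∀ z : Vertex d, P.map (moveWeights (translation z)) = P
  ergodic : ∀ s : Set (Weights d), MeasurableSet s →
    (∀ z : Vertex d, moveWeights (translation z) ⁻¹' s = s) → P s = 0 ∨ P s = 1
  symmetric : ∀ φ : lattice d ≃g lattice d, P.map (moveWeights φ) = P
  moment : ∃ ε : ℝ, 0 < ε ∧ ∀ e : Edge d, ∫⁻ t : Weights d, (t e : ℝ≥0∞) ^ ((d : ℝ) + ε) ∂P < ∞
  bounded_shape : Bornology.IsBounded (limitShape P)
  unique_times : ∀ (x y x' y' : Vertex d) (p : (lattice d).Walk x y) (q : (lattice d).Walk x' y'),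
    {e | e ∈ p.edges} ≠ {e | e ∈ q.edges} → P {t | pathTime t p = pathTime t q} = 0
  finite_energy : ∀ (e : Edge d) (l : ℝ≥0), 0 < l → 0 < P {t | l ≤ t e} →
    ∀ᵐ t ∂P, 0 < (P⟦{t : Weights d | l ≤ t e} | sigmaOff e⟧) t

/-- `H = {z : z · ρ = 1}` supports the limit shape at some point `z₀` of it (the limit shape
contains the origin, hence lies on the side `z · ρ ≤ 1`). -/
def IsSupporting (P : Measure (Weights d)) (ρ : Fin d → ℝ) : Prop :=
  (∃ z₀ ∈ limitShape P, z₀ ∈ hyperplane ρ 1) ∧ ∀ z ∈ limitShape P, z ⬝ᵥ ρ ≤ 1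

/-- `S`, the supremum of the support of the law of `t_e`, possibly infinite. -/
def supSupport (P : Measure (Weights d)) (e : Edge d) : ℝ≥0∞ :=
  ⨆ (x : ℝ≥0) (_ : 0 < P {t | x ≤ t e}), (x : ℝ≥0∞)

/-! ### Geodesic measures -/

/-- `B_α(x,y) = T(x, H_ρ(α)) - T(y, H_ρ(α))`. -/
def busemann (ρ : Fin d → ℝ) (α : ℝ) (t : Weights d) : Increments d :=
  fun xy => (planeTime t ρ α xy.1 : ℝ) - (planeTime t ρ α xy.2 : ℝ)

open Classical in
/-- `η_α(⟨x,y⟩) = 1` iff the edge `{x,y}` is in a geodesic from `x` to `H_ρ(α)`. -/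
def geoGraph (ρ : Fin d → ℝ) (α : ℝ) (t : Weights d) : GraphConfig d :=
  fun a => decide (∃ (v : Vertex d) (p : (lattice d).Walk a.fst v),
    IsPlaneGeodesic t ρ α p ∧ a.edge ∈ p.edges)

/-- The map `Φ_α : ω ↦ ((t_e), B_α, η_α)`. -/
def Phi (ρ : Fin d → ℝ) (α : ℝ) (t : Weights d) : Extended d :=
  (t, busemann ρ α t, geoGraph ρ α t)

/-- `μ_α`, the image of `P` under `Φ_α`. -/
def planeMeasure (P : Measure (Weights d)) (ρ : Fin d → ℝ) (α : ℝ) : Measure (Extended d) :=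
  P.map (Phi ρ α)

/-- `μ_n^* = (1/n) ∫_0^n μ_α dα`. -/
def averageMeasure (P : Measure (Weights d)) (ρ : Fin d → ℝ) (n : ℕ) : Measure (Extended d) :=
  (n : ℝ≥0∞)⁻¹ • (volume.restrict (Set.Icc (0 : ℝ) n)).bind (planeMeasure P ρ)

/-- `μ` is a probability measure that is a subsequential weak limit of `(μ_n^*)`. -/
structure IsGeodesicMeasure (P : Measure (Weights d)) (ρ : Fin d → ℝ)
    (μ : Measure (Extended d)) : Prop where
  isProb : IsProbabilityMeasure μ
  limit : ∃ n : ℕ → ℕ, StrictMono n ∧ ∀ f : Extended d →ᵇ ℝ,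
    Tendsto (fun k => ∫ ω, f ω ∂(averageMeasure P ρ (n k))) atTop (𝓝 (∫ ω, f ω ∂μ))

/-! ### Approximable events -/

/-- An event of `Ω₁ × Ω₃`, viewed on the full space by leaving the `Ω₂`-coordinate free. -/
def liftEvent (A : Set (Weights d × GraphConfig d)) : Set (Extended d) :=
  {ω | (ω.1, ω.2.2) ∈ A}

/-- Cylinder events `{η(e₁) = a₁, …, η(e_n) = a_n}` of `Ω₃`. -/
def IsCylinder (V : Set (GraphConfig d)) : Prop :=
  ∃ L : Finset (DirEdge d × Bool), V = {η | ∀ c ∈ L, η c.1 = c.2}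

/-- Graph-cylinder events: finite unions of `U × V` with `U` Borel and `V` a cylinder event. -/
def IsGraphCylinder (A : Set (Weights d × GraphConfig d)) : Prop :=
  ∃ (m : ℕ) (U : Fin m → Set (Weights d)) (V : Fin m → Set (GraphConfig d)),
    (∀ i, MeasurableSet (U i)) ∧ (∀ i, IsCylinder (V i)) ∧ A = ⋃ i, U i ×ˢ V i

/-- `e₀`-approximable events for `μ`. -/
def IsApproximable (ρ : Fin d → ℝ) (μ : Measure (Extended d)) (e₀ : Edge d)
    (A : Set (Weights d × GraphConfig d)) : Prop :=
  MeasurableSet A ∧ ∃ A' : ℕ → Set (Weights d × GraphConfig d),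
    (∀ n, IsGraphCylinder (A' n)) ∧
    Tendsto (fun n => μ (liftEvent (symmDiff (A' n) A))) atTop (𝓝 0) ∧
    ∀ n, ∃ α₀ : ℝ, ∀ α ≥ α₀, ∀ t t' : Weights d,
      t e₀ ≤ t' e₀ → (∀ e, e ≠ e₀ → t' e = t e) →
      (t, geoGraph ρ α t) ∈ A' n → (t', geoGraph ρ α t') ∈ A' n

end FPP

end

/-!
Raising the weight of `e₀` above `l` costs a bounded factor up to an arbitrarily small error: where
`P(t_{e₀} ≥ l ∣ (t_f)_{f ≠ e₀})` exceeds `1/K`, an event `D` determined by the other weights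
satisfies `P(D) ≤ K P(D, t_{e₀} ≥ l)`, and the complementary set of weights has small probability
for `K` large. If `B` is increasing in `t_{e₀}`, comparison with `D = {t : t with t_{e₀} set to l
lies in B}` yields `P(B) ≤ (K + 1) P(B, t_{e₀} ≥ l) + ε`.

For a graph-cylinder event this inequality holds under `μ_α` for all large `α`. Being linear, it is
preserved by averaging over `α`. It passes to the weak limit because all the measures `μ_n^*` have
the same marginal `P` on the weights: a Borel set of weights is squeezed between a closed and an
open one whose `P`-measures nearly agree, uniformly in `n`, and cylinder events are clopen. Finally
it passes to `e₀`-approximable events.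
-/

namespace FPP

/-! ### Events increasing in one coordinate -/

section ConditionalProbability

variable {Ω : Type*} {m m₀ : MeasurableSpace Ω} {P : Measure[m₀] Ω} [IsFiniteMeasure P]

lemma measure_le_mul_measure_inter_of_le_condExp (hm : m ≤ m₀) {D E : Set Ω}
    (hD : MeasurableSet[m] D) (hE : MeasurableSet[m₀] E) {K : ℝ≥0}
    (hK : ∀ ω ∈ D, 1 ≤ K * (P⟦E | m⟧) ω) : P D ≤ K * P (D ∩ E) := by
  have hreal : P.real D ≤ K * P.real (D ∩ E) :=
    calc P.real D = ∫ _ in D, (1 : ℝ) ∂P := by simp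
      _ ≤ ∫ ω in D, K * (P⟦E | m⟧) ω ∂P :=
        setIntegral_mono_on (integrable_const _).integrableOn
          (integrable_condExp.const_mul _).integrableOn (hm _ hD) hK
      _ = K * ∫ ω in D, E.indicator (fun _ => (1 : ℝ)) ω ∂P := by
        rw [integral_const_mul, setIntegral_condExp hm ((integrable_const _).indicator hE) hD]
      _ = K * P.real (D ∩ E) := by
        rw [setIntegral_indicator hE, setIntegral_const, smul_eq_mul, mul_one]
  rw [← ENNReal.toReal_le_toReal (measure_ne_top _ _)
    (ENNReal.mul_ne_top ENNReal.coe_ne_top (measure_ne_top _ _)), ENNReal.toReal_mul]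
  exact hreal

lemma exists_measure_mul_lt_one_le {Ω : Type*} [MeasurableSpace Ω] {P : Measure Ω}
    [IsFiniteMeasure P] {X : Ω → ℝ} (hX : Measurable X) (hpos : ∀ᵐ ω ∂P, 0 < X ω)
    {ε : ℝ≥0∞} (hε : ε ≠ 0) : ∃ K : ℝ≥0, P {ω | K * X ω < 1} ≤ ε := by
  let low : ℕ → Set Ω := fun n => {ω | X ω < 1 / ((n : ℝ) + 1)}
  have hanti : Antitone low := fun i j hij ω (hω : X ω < _) =>
    hω.trans_le (Nat.one_div_le_one_div hij)
  have hnull : P (⋂ n, low n) = 0 := by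
    refine measure_mono_null (fun ω hω => ?_) (ae_iff.mp hpos)
    intro hlt
    obtain ⟨n, hn⟩ := exists_nat_one_div_lt hlt
    exact lt_asymm hn (Set.mem_iInter.mp hω n)
  have hlim : Tendsto (fun n => P (low n)) atTop (𝓝 0) := hnull ▸
    tendsto_measure_iInter_atTop (fun _ => (hX measurableSet_Iio).nullMeasurableSet) hanti
      ⟨0, measure_ne_top _ _⟩
  obtain ⟨n, hn⟩ := (hlim.eventually_lt_const (pos_iff_ne_zero.mpr hε)).exists
  refine ⟨n + 1, (measure_mono fun ω hω => ?_).trans hn.le⟩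
  have hn₀ : (0 : ℝ) < n + 1 := by positivity
  exact (lt_div_iff₀' hn₀).mpr (by simpa using hω)

lemma exists_measure_le_mul_measure_inter_add (hm : m ≤ m₀) {E : Set Ω}
    (hE : MeasurableSet[m₀] E) (hpos : ∀ᵐ ω ∂P, 0 < (P⟦E | m⟧) ω) {ε : ℝ≥0∞} (hε : ε ≠ 0) :
    ∃ K : ℝ≥0, ∀ D, MeasurableSet[m] D → P D ≤ K * P (D ∩ E) + ε := by
  have hX : Measurable[m] (P⟦E | m⟧) := stronglyMeasurable_condExp.measurable
  obtain ⟨K, hK⟩ := exists_measure_mul_lt_one_le (hX.mono hm le_rfl) hpos hε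
  set low : Set Ω := {ω | K * (P⟦E | m⟧) ω < 1}
  have hlow : MeasurableSet[m] low := (hX.const_mul _) measurableSet_Iio
  refine ⟨K, fun D hD => ?_⟩
  calc P D ≤ P (D \ low) + P low := by
        refine (measure_mono ?_).trans (measure_union_le _ _)
        rw [Set.sdiff_union_self]
        exact Set.subset_union_left
    _ ≤ K * P ((D \ low) ∩ E) + ε := add_le_add
        (measure_le_mul_measure_inter_of_le_condExp hm (hD.diff hlow) hE
          fun ω hω => not_lt.mp hω.2) hK
    _ ≤ K * P (D ∩ E) + ε := by gcongr; exact Set.sdiff_subset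

end ConditionalProbability

lemma measurable_update_cylinderEvents_compl {ι : Type*} [DecidableEq ι] {X : ι → Type*}
    [∀ i, MeasurableSpace (X i)] (i : ι) (x : X i) :
    Measurable[cylinderEvents {i}ᶜ] fun t : ∀ j, X j => Function.update t i x := by
  refine @measurable_pi_lambda _ _ _ (_) _ _ fun j => ?_
  rcases eq_or_ne j i with rfl | hj
  · simp only [Function.update_self]
    exact measurable_const
  · simp only [Function.update_of_ne hj]
    exact measurable_cylinderEvent_apply hj

lemma indep_comap_eval_cylinderEvents_compl {ι : Type*} {X : ι → Type*}
    [∀ i, MeasurableSpace (X i)] {P : Measure (∀ i, X i)}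
    (hP : iIndepFun (fun i (t : ∀ i, X i) => t i) P) (i : ι) :
    Indep (MeasurableSpace.comap (fun t : ∀ i, X i => t i) inferInstance)
      (cylinderEvents {i}ᶜ) P := by
  have h := indep_iSup_of_disjoint (fun j => (measurable_pi_apply j).comap_le) hP.iIndep
    (S := {i}) (T := {i}ᶜ) disjoint_compl_right
  rwa [iSup_singleton] at h

/-- A set of configurations that is stable under raising the `i`-th coordinate. -/
def IncreasingIn {ι X : Type*} [LE X] (i : ι) (B : Set (ι → X)) : Prop :=
  ∀ t t' : ι → X, t i ≤ t' i → (∀ j, j ≠ i → t' j = t j) → t ∈ B → t' ∈ B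

lemma IncreasingIn.measure_le {ι X : Type*} [LinearOrder X] [MeasurableSpace X]
    {P : Measure (ι → X)} {i : ι} {l : X} {K ε : ℝ≥0∞}
    (hK : ∀ D, MeasurableSet[cylinderEvents {i}ᶜ] D → P D ≤ K * P (D ∩ {t | l ≤ t i}) + ε)
    {B : Set (ι → X)} (hinc : IncreasingIn i B) (hB : MeasurableSet B) :
    P B ≤ (K + 1) * P (B ∩ {t | l ≤ t i}) + ε := by
  classical
  let D : Set (ι → X) := {t | Function.update t i l ∈ B}
  have hD : MeasurableSet[cylinderEvents {i}ᶜ] D :=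
    measurable_update_cylinderEvents_compl (X := fun _ => X) i l hB
  have hBD : B ⊆ D ∪ (B ∩ {t | l ≤ t i}) := fun t ht =>
    (le_total l (t i)).elim (fun h => Or.inr ⟨ht, h⟩) fun h => Or.inl <|
      hinc t _ (by simpa using h) (fun j hj => Function.update_of_ne hj _ _) ht
  have hDB : D ∩ {t | l ≤ t i} ⊆ B ∩ {t | l ≤ t i} := fun t ht =>
    ⟨hinc _ t (by simpa using ht.2) (fun j hj => (Function.update_of_ne hj _ _).symm) ht.1, ht.2⟩
  calc P B ≤ P D + P (B ∩ {t | l ≤ t i}) := (measure_mono hBD).trans (measure_union_le _ _)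
    _ ≤ (K * P (D ∩ {t | l ≤ t i}) + ε) + P (B ∩ {t | l ≤ t i}) := by gcongr; exact hK D hD
    _ ≤ (K * P (B ∩ {t | l ≤ t i}) + ε) + P (B ∩ {t | l ≤ t i}) := by gcongr
    _ = (K + 1) * P (B ∩ {t | l ≤ t i}) + ε := by ring

/-! ### Weak limits of measures with a common marginal -/

/-- `C` is squeezed between a closed and an open set whose difference has small mass, uniformly over
the family `ν`. The measure of such a set passes to weak limits. -/
def IsUniformlyRegular {ι Ω : Type*} [TopologicalSpace Ω] [MeasurableSpace Ω]
    (ν : ι → Measure Ω) (C : Set Ω) : Prop :=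
  ∀ ε : ℝ≥0∞, ε ≠ 0 → ∃ F G, IsClosed F ∧ IsOpen G ∧ F ⊆ C ∧ C ⊆ G ∧ ∀ i, ν i (G \ F) ≤ ε

lemma IsUniformlyRegular.tendsto_measure {ι Ω : Type*} [TopologicalSpace Ω] [MeasurableSpace Ω]
    [OpensMeasurableSpace Ω] [HasOuterApproxClosed Ω] {L : Filter ι}
    {ν : ι → ProbabilityMeasure Ω} {μ : ProbabilityMeasure Ω} {C : Set Ω}
    (hC : IsUniformlyRegular (fun i => (ν i : Measure Ω)) C) (hν : Tendsto ν L (𝓝 μ)) :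
    Tendsto (fun i => (ν i : Measure Ω) C) L (𝓝 ((μ : Measure Ω) C)) := by
  rcases L.eq_or_neBot with rfl | hL
  · exact tendsto_bot
  refine tendsto_of_le_liminf_of_limsup_le
    (ENNReal.le_of_forall_pos_le_add fun ε hε _ => ?_)
    (ENNReal.le_of_forall_pos_le_add fun ε hε _ => ?_) <;>
  obtain ⟨F, G, hF, hG, hFC, hCG, hGF⟩ := hC ε (by simpa using hε.ne')
  · have hG_le : ∀ i, (ν i : Measure Ω) G ≤ (ν i : Measure Ω) C + ε := fun i =>
      calc (ν i : Measure Ω) G ≤ (ν i : Measure Ω) (C ∪ G \ F) :=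
            measure_mono fun ω hω => (em (ω ∈ F)).imp (@hFC ω) fun h => ⟨hω, h⟩
        _ ≤ (ν i : Measure Ω) C + ε := (measure_union_le _ _).trans (by gcongr; exact hGF i)
    calc (μ : Measure Ω) C ≤ (μ : Measure Ω) G := measure_mono hCG
      _ ≤ liminf (fun i => (ν i : Measure Ω) G) L :=
        ProbabilityMeasure.le_liminf_measure_open_of_tendsto hν hG
      _ ≤ liminf (fun i => (ν i : Measure Ω) C + ε) L := liminf_le_liminf (.of_forall hG_le)
      _ = liminf (fun i => (ν i : Measure Ω) C) L + ε :=
        liminf_add_const L _ _ (by isBoundedDefault) (by isBoundedDefault)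
  · have hC_le : ∀ i, (ν i : Measure Ω) C ≤ (ν i : Measure Ω) F + ε := fun i =>
      calc (ν i : Measure Ω) C ≤ (ν i : Measure Ω) (F ∪ G \ F) :=
            measure_mono fun ω hω => (em (ω ∈ F)).imp id fun h => ⟨hCG hω, h⟩
        _ ≤ (ν i : Measure Ω) F + ε := (measure_union_le _ _).trans (by gcongr; exact hGF i)
    calc limsup (fun i => (ν i : Measure Ω) C) L
        ≤ limsup (fun i => (ν i : Measure Ω) F + ε) L := limsup_le_limsup (.of_forall hC_le)
      _ = limsup (fun i => (ν i : Measure Ω) F) L + ε :=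
        limsup_add_const L _ _ (by isBoundedDefault) (by isBoundedDefault)
      _ ≤ (μ : Measure Ω) F + ε := by
        gcongr; exact ProbabilityMeasure.limsup_measure_closed_le_of_tendsto hν hF
      _ ≤ (μ : Measure Ω) C + ε := by gcongr

lemma IsUniformlyRegular.iUnion {ι κ Ω : Type*} [Finite κ] [TopologicalSpace Ω]
    [MeasurableSpace Ω] {ν : ι → Measure Ω} {C : κ → Set Ω}
    (hC : ∀ k, IsUniformlyRegular ν (C k)) : IsUniformlyRegular ν (⋃ k, C k) := by
  intro ε hε
  obtain ⟨δ, hδ, hδε⟩ := ENNReal.exists_pos_sum_of_countable' hε κ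
  choose F G hF hG hFC hCG hGF using fun k => hC k (δ k) (hδ k).ne'
  refine ⟨⋃ k, F k, ⋃ k, G k, isClosed_iUnion_of_finite hF, isOpen_iUnion hG,
    Set.iUnion_mono hFC, Set.iUnion_mono hCG, fun i => ?_⟩
  have hdiff : (⋃ k, G k) \ ⋃ k, F k ⊆ ⋃ k, G k \ F k := by
    rw [Set.iUnion_sdiff]
    exact Set.iUnion_mono fun k => Set.sdiff_subset_sdiff_right (Set.subset_iUnion F k)
  calc ν i ((⋃ k, G k) \ ⋃ k, F k) ≤ ∑' k, ν i (G k \ F k) :=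
        (measure_mono hdiff).trans (measure_iUnion_le _)
    _ ≤ ∑' k, δ k := ENNReal.tsum_le_tsum fun k => hGF k i
    _ ≤ ε := hδε.le

lemma isUniformlyRegular_prod {ι X Y : Type*} [TopologicalSpace X] [MeasurableSpace X]
    [OpensMeasurableSpace X] [TopologicalSpace Y] [MeasurableSpace Y]
    {P : Measure X} [IsFiniteMeasure P] [P.WeaklyRegular] {ν : ι → Measure (X × Y)}
    (hν : ∀ i, (ν i).map Prod.fst = P) {U : Set X} (hU : MeasurableSet U) {V : Set Y}
    (hV : IsClopen V) : IsUniformlyRegular ν (U ×ˢ V) := by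
  intro ε hε
  have hε2 : ε / 2 ≠ 0 := by simpa using hε
  obtain ⟨F, hFU, hF, hUF⟩ := hU.exists_isClosed_sdiff_lt (measure_ne_top P U) hε2
  obtain ⟨G, hUG, hG, -, hGU⟩ := hU.exists_isOpen_sdiff_lt (measure_ne_top P U) hε2
  refine ⟨F ×ˢ V, G ×ˢ V, hF.prod hV.isClosed, hG.prod hV.isOpen, Set.prod_mono_left hFU,
    Set.prod_mono_left hUG, fun i => ?_⟩
  calc ν i (G ×ˢ V \ F ×ˢ V) ≤ ν i (Prod.fst ⁻¹' (G \ F)) :=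
        measure_mono fun ω hω => ⟨hω.1.1, fun h => hω.2 ⟨h, hω.1.2⟩⟩
    _ = P (G \ F) := by
        rw [← hν i, Measure.map_apply measurable_fst (hG.measurableSet.diff hF.measurableSet)]
    _ ≤ P (G \ U) + P (U \ F) :=
        (measure_mono (sdiff_triangle G U F)).trans (measure_union_le _ _)
    _ ≤ ε := (add_le_add hGU.le hUF.le).trans_eq (ENNReal.add_halves ε)

variable {d : ℕ}

/-! ### Joint measurability in the level of the hyperplane and the weights -/

instance : Countable (DirEdge d) :=
  (SimpleGraph.Dart.toProd_injective (G := lattice d)).countable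

instance (x y : Vertex d) : Countable ((lattice d).Walk x y) :=
  (SimpleGraph.Walk.support_injective (G := lattice d)).countable

lemma measurable_pathTime {x y : Vertex d} (p : (lattice d).Walk x y) :
    Measurable fun t : Weights d => pathTime t p := by
  unfold pathTime
  induction p.darts with
  | nil => exact measurable_const
  | cons a l ih =>
    simp only [List.map_cons, List.sum_cons]
    exact (measurable_pi_apply _).add ih

lemma measurable_vertexTime (x y : Vertex d) :
    Measurable fun t : Weights d => vertexTime t x y :=
  Measurable.iInf measurable_pathTime

/-- The levels `α` for which `v` is the integer part of a point of `H_ρ(α)`. There are only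
countably many `v`, which makes infima over the hyperplane measurable. -/
def levelSet (ρ : Fin d → ℝ) (v : Vertex d) : Set ℝ :=
  {α | ∃ z ∈ hyperplane ρ α, floorPt z = v}

lemma levelSet_eq_image_pi_Ico (ρ : Fin d → ℝ) (v : Vertex d) :
    levelSet ρ v = (· ⬝ᵥ ρ) '' Set.univ.pi fun i => Set.Ico (v i : ℝ) (v i + 1) := by
  ext α
  simp only [levelSet, hyperplane, floorPt, funext_iff, Int.floor_eq_iff, Set.mem_image,
    Set.mem_univ_pi, Set.mem_Ico, Set.mem_ofPred_eq]
  exact exists_congr fun z => and_comm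

lemma measurableSet_levelSet (ρ : Fin d → ℝ) (v : Vertex d) : MeasurableSet (levelSet ρ v) := by
  have hlin : IsLinearMap ℝ fun z : Fin d → ℝ => z ⬝ᵥ ρ :=
    ⟨fun x y => add_dotProduct x y ρ, fun c x => smul_dotProduct c x ρ⟩
  rw [levelSet_eq_image_pi_Ico]
  exact ((convex_pi fun i _ => convex_Ico _ _).is_linear_image hlin).ordConnected.measurableSet

lemma hyperplane_nonempty {ρ : Fin d → ℝ} (hρ : ρ ≠ 0) (α : ℝ) : (hyperplane ρ α).Nonempty := by
  obtain ⟨i, hi⟩ := Function.ne_iff.mp hρ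
  exact ⟨Pi.single i (α / ρ i), by
    rw [hyperplane, Set.mem_ofPred_eq, single_dotProduct, div_mul_cancel₀ _ hi]⟩

lemma planeTime_lt_iff {ρ : Fin d → ℝ} (hρ : ρ ≠ 0) {t : Weights d} {α : ℝ} {x : Vertex d}
    {c : ℝ≥0} : planeTime t ρ α x < c ↔ ∃ v, α ∈ levelSet ρ v ∧ vertexTime t x v < c := by
  have := (hyperplane_nonempty hρ α).to_subtype
  rw [planeTime, ciInf_lt_iff (OrderBot.bddBelow _), Subtype.exists]
  constructor
  · rintro ⟨z, hz, hlt⟩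
    exact ⟨_, ⟨z, hz, rfl⟩, hlt⟩
  · rintro ⟨_, ⟨z, hz, rfl⟩, hlt⟩
    exact ⟨z, hz, hlt⟩

lemma measurable_planeTime {ρ : Fin d → ℝ} (hρ : ρ ≠ 0) (x : Vertex d) :
    Measurable fun q : ℝ × Weights d => planeTime q.2 ρ q.1 x := by
  refine measurable_of_Iio fun c => ?_
  simp only [Set.preimage, Set.mem_Iio, planeTime_lt_iff hρ, Set.ofPred_exists]
  exact .iUnion fun v => (measurable_fst (measurableSet_levelSet ρ v)).inter
    (((measurable_vertexTime x v).comp measurable_snd) measurableSet_Iio)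

lemma measurable_geoGraph {ρ : Fin d → ℝ} (hρ : ρ ≠ 0) :
    Measurable fun q : ℝ × Weights d => geoGraph ρ q.1 q.2 := by
  refine measurable_pi_lambda _ fun a => measurable_to_bool ?_
  simp only [Set.preimage, Set.mem_singleton_iff, geoGraph, decide_eq_true_eq, Set.ofPred_exists]
  refine .iUnion fun v => .iUnion fun p => .inter (.inter ?_ ?_) (.const _)
  · exact measurable_fst (measurableSet_levelSet ρ v)
  · exact measurableSet_eq_fun ((measurable_pathTime p).comp measurable_snd)
      (measurable_planeTime hρ a.fst)

lemma measurable_Phi {ρ : Fin d → ℝ} (hρ : ρ ≠ 0) :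
    Measurable fun q : ℝ × Weights d => Phi ρ q.1 q.2 :=
  measurable_snd.prodMk <| .prodMk
    (measurable_pi_lambda _ fun xy => (measurable_planeTime hρ xy.1).coe_nnreal_real.sub
      (measurable_planeTime hρ xy.2).coe_nnreal_real)
    (measurable_geoGraph hρ)

lemma planeMeasure_apply (P : Measure (Weights d)) {ρ : Fin d → ℝ} (hρ : ρ ≠ 0) (α : ℝ)
    {S : Set (Extended d)} (hS : MeasurableSet S) :
    planeMeasure P ρ α S = P (Phi ρ α ⁻¹' S) :=
  Measure.map_apply ((measurable_Phi hρ).comp measurable_prodMk_left) hS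

lemma measurable_planeMeasure (P : Measure (Weights d)) [SFinite P] {ρ : Fin d → ℝ} (hρ : ρ ≠ 0) :
    Measurable (planeMeasure P ρ) := by
  refine Measure.measurable_of_measurable_coe _ fun S hS => ?_
  simp only [planeMeasure_apply P hρ _ hS]
  exact measurable_measure_prodMk_left (measurable_Phi hρ hS)

/-! ### The averaged measures -/

lemma averageMeasure_apply (P : Measure (Weights d)) [SFinite P] {ρ : Fin d → ℝ} (hρ : ρ ≠ 0)
    (n : ℕ) {S : Set (Extended d)} (hS : MeasurableSet S) :
    averageMeasure P ρ n S = (n : ℝ≥0∞)⁻¹ * ∫⁻ α in Set.Icc (0 : ℝ) n, planeMeasure P ρ α S := by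
  rw [averageMeasure, Measure.smul_apply, smul_eq_mul,
    Measure.bind_apply hS (measurable_planeMeasure P hρ).aemeasurable]

lemma map_fst_averageMeasure (P : Measure (Weights d)) [SFinite P] {ρ : Fin d → ℝ} (hρ : ρ ≠ 0)
    {n : ℕ} (hn : n ≠ 0) : (averageMeasure P ρ n).map Prod.fst = P := by
  ext S hS
  have hplane : ∀ α, planeMeasure P ρ α (Prod.fst ⁻¹' S) = P S := fun α =>
    planeMeasure_apply P hρ α (measurable_fst hS)
  rw [Measure.map_apply measurable_fst hS, averageMeasure_apply P hρ n (measurable_fst hS)]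
  simp only [hplane, lintegral_const, Measure.restrict_apply_univ, Real.volume_Icc, sub_zero,
    ENNReal.ofReal_natCast]
  rw [mul_left_comm, ENNReal.inv_mul_cancel (Nat.cast_ne_zero.mpr hn) (ENNReal.natCast_ne_top n),
    mul_one]

lemma isProbabilityMeasure_averageMeasure (P : Measure (Weights d)) [IsProbabilityMeasure P]
    {ρ : Fin d → ℝ} (hρ : ρ ≠ 0) {n : ℕ} (hn : n ≠ 0) :
    IsProbabilityMeasure (averageMeasure P ρ n) := by
  rw [← Measure.isProbabilityMeasure_map_iff measurable_fst.aemeasurable,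
    map_fst_averageMeasure P hρ hn]
  infer_instance

lemma setLIntegral_Icc_le_add_of_forall_ge {f g : ℝ → ℝ≥0∞} (hg : Measurable g)
    (hf : ∀ x, f x ≤ 1) {c : ℝ} (h : ∀ x ≥ c, f x ≤ g x) (a b : ℝ) :
    ∫⁻ x in Set.Icc a b, f x ≤ (∫⁻ x in Set.Icc a b, g x) + ENNReal.ofReal (c - a) := by
  have hpoint : ∀ x, f x ≤ g x + (Set.Iio c).indicator 1 x := fun x => by
    by_cases hx : x < c
    · simpa [Set.indicator_of_mem (Set.mem_Iio.mpr hx)] using (hf x).trans le_add_self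
    · exact (h x (not_lt.mp hx)).trans le_self_add
  calc ∫⁻ x in Set.Icc a b, f x
      ≤ ∫⁻ x in Set.Icc a b, (g x + (Set.Iio c).indicator 1 x) := lintegral_mono hpoint
    _ = (∫⁻ x in Set.Icc a b, g x) + volume (Set.Iio c ∩ Set.Icc a b) := by
        rw [lintegral_add_left hg, lintegral_indicator_one measurableSet_Iio,
          Measure.restrict_apply measurableSet_Iio]
    _ ≤ (∫⁻ x in Set.Icc a b, g x) + ENNReal.ofReal (c - a) := by
        rw [← Real.volume_Ico]
        gcongr
        exact fun x hx => ⟨hx.2.1, hx.1⟩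

lemma averageMeasure_le_of_forall_ge {P : Measure (Weights d)} [IsProbabilityMeasure P]
    {ρ : Fin d → ℝ} (hρ : ρ ≠ 0) {S S' : Set (Extended d)} (hS : MeasurableSet S)
    (hS' : MeasurableSet S') {c ε : ℝ≥0∞} {α₀ : ℝ}
    (h : ∀ α ≥ α₀, planeMeasure P ρ α S ≤ c * planeMeasure P ρ α S' + ε) {n : ℕ} (hn : n ≠ 0) :
    averageMeasure P ρ n S ≤
      c * averageMeasure P ρ n S' + ε + (n : ℝ≥0∞)⁻¹ * ENNReal.ofReal α₀ := by
  have hmeas : Measurable fun α => planeMeasure P ρ α S' :=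
    (Measure.measurable_coe hS').comp (measurable_planeMeasure P hρ)
  have hle_one : ∀ α, planeMeasure P ρ α S ≤ 1 := fun α =>
    (planeMeasure_apply P hρ α hS).trans_le prob_le_one
  have hint := setLIntegral_Icc_le_add_of_forall_ge ((hmeas.const_mul c).add_const ε) hle_one h 0 n
  rw [lintegral_add_left (hmeas.const_mul _), lintegral_const_mul _ hmeas, lintegral_const,
    Measure.restrict_apply_univ, Real.volume_Icc, sub_zero, sub_zero,
    ENNReal.ofReal_natCast] at hint
  rw [averageMeasure_apply P hρ n hS, averageMeasure_apply P hρ n hS']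
  calc (n : ℝ≥0∞)⁻¹ * ∫⁻ α in Set.Icc (0 : ℝ) n, planeMeasure P ρ α S
      ≤ (n : ℝ≥0∞)⁻¹ * (c * (∫⁻ α in Set.Icc (0 : ℝ) n, planeMeasure P ρ α S') + ε * n
          + ENNReal.ofReal α₀) := by gcongr
    _ = c * ((n : ℝ≥0∞)⁻¹ * ∫⁻ α in Set.Icc (0 : ℝ) n, planeMeasure P ρ α S')
          + ε * ((n : ℝ≥0∞)⁻¹ * n) + (n : ℝ≥0∞)⁻¹ * ENNReal.ofReal α₀ := by ring
    _ = c * ((n : ℝ≥0∞)⁻¹ * ∫⁻ α in Set.Icc (0 : ℝ) n, planeMeasure P ρ α S')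
          + ε + (n : ℝ≥0∞)⁻¹ * ENNReal.ofReal α₀ := by
        rw [ENNReal.inv_mul_cancel (Nat.cast_ne_zero.mpr hn) (ENNReal.natCast_ne_top n), mul_one]

lemma IsGeodesicMeasure.exists_tendsto_averageMeasure {P : Measure (Weights d)}
    [IsProbabilityMeasure P] {ρ : Fin d → ℝ} (hρ : ρ ≠ 0) {μ : Measure (Extended d)}
    (hμ : IsGeodesicMeasure P ρ μ) :
    ∃ (n : ℕ → ℕ) (ν : ℕ → ProbabilityMeasure (Extended d)), (∀ k, n k ≠ 0) ∧
      Tendsto n atTop atTop ∧ (∀ k, (ν k : Measure (Extended d)) = averageMeasure P ρ (n k)) ∧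
      Tendsto ν atTop (𝓝 ⟨μ, hμ.isProb⟩) := by
  obtain ⟨n, hn, hlim⟩ := hμ.limit
  have hn₀ : ∀ k, n (k + 1) ≠ 0 := fun k => Nat.ne_zero_of_lt (hn k.lt_succ_self)
  refine ⟨fun k => n (k + 1),
    fun k => ⟨averageMeasure P ρ (n (k + 1)), isProbabilityMeasure_averageMeasure P hρ (hn₀ k)⟩,
    hn₀, hn.tendsto_atTop.comp (tendsto_add_atTop_nat 1), fun k => rfl, ?_⟩
  exact ProbabilityMeasure.tendsto_iff_forall_integral_tendsto.mpr fun f =>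
    (hlim f).comp (tendsto_add_atTop_nat 1)

/-! ### Graph-cylinder events and approximable events -/

lemma IsCylinder.isClopen {V : Set (GraphConfig d)} (hV : IsCylinder V) : IsClopen V := by
  obtain ⟨L, rfl⟩ := hV
  simp only [Set.ofPred_forall]
  exact isClopen_biInter_finset fun c _ =>
    (isClopen_discrete {c.2}).preimage (continuous_apply c.1)

lemma IsGraphCylinder.measurableSet {C : Set (Weights d × GraphConfig d)}
    (hC : IsGraphCylinder C) : MeasurableSet C := by
  obtain ⟨m, U, V, hU, hV, rfl⟩ := hC
  exact .iUnion fun i => (hU i).prod (hV i).isClopen.isOpen.measurableSet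

lemma IsGraphCylinder.inter_fst_preimage {C : Set (Weights d × GraphConfig d)}
    (hC : IsGraphCylinder C) {W : Set (Weights d)} (hW : MeasurableSet W) :
    IsGraphCylinder (C ∩ Prod.fst ⁻¹' W) := by
  obtain ⟨m, U, V, hU, hV, rfl⟩ := hC
  refine ⟨m, fun i => U i ∩ W, V, fun i => (hU i).inter hW, hV, ?_⟩
  rw [← Set.prod_univ, Set.iUnion_inter]
  simp only [Set.prod_inter_prod, Set.inter_univ]

lemma measurableSet_liftEvent {A : Set (Weights d × GraphConfig d)} (hA : MeasurableSet A) :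
    MeasurableSet (liftEvent A) :=
  (measurable_fst.prodMk measurable_snd.snd) hA

lemma IsGraphCylinder.isUniformlyRegular_liftEvent {ι : Type*} {P : Measure (Weights d)}
    [IsFiniteMeasure P] {ν : ι → Measure (Extended d)} (hν : ∀ i, (ν i).map Prod.fst = P)
    {C : Set (Weights d × GraphConfig d)} (hC : IsGraphCylinder C) :
    IsUniformlyRegular ν (liftEvent C) := by
  obtain ⟨m, U, V, hU, hV, rfl⟩ := hC
  have hunion : liftEvent (⋃ i, U i ×ˢ V i) =
      ⋃ i, U i ×ˢ (Prod.snd ⁻¹' V i : Set (Increments d × GraphConfig d)) := by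
    ext ω
    simp [liftEvent]
  rw [hunion]
  exact .iUnion fun i =>
    isUniformlyRegular_prod hν (hU i) ((hV i).isClopen.preimage continuous_snd)

lemma IsGeodesicMeasure.measure_graphCylinder_le {P : Measure (Weights d)}
    [IsProbabilityMeasure P] {ρ : Fin d → ℝ} (hρ : ρ ≠ 0) {μ : Measure (Extended d)}
    (hμ : IsGeodesicMeasure P ρ μ) {C C' : Set (Weights d × GraphConfig d)}
    (hC : IsGraphCylinder C) (hC' : IsGraphCylinder C') {c ε : ℝ≥0∞} (hc : c ≠ ∞) {α₀ : ℝ}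
    (h : ∀ α ≥ α₀, planeMeasure P ρ α (liftEvent C) ≤
      c * planeMeasure P ρ α (liftEvent C') + ε) :
    μ (liftEvent C) ≤ c * μ (liftEvent C') + ε := by
  obtain ⟨n, ν, hn₀, hn, hν, hνμ⟩ := hμ.exists_tendsto_averageMeasure hρ
  have hmarginal : ∀ k, (ν k : Measure (Extended d)).map Prod.fst = P := fun k => by
    rw [hν, map_fst_averageMeasure P hρ (hn₀ k)]
  have hlim : ∀ {B}, IsGraphCylinder B →
      Tendsto (fun k => averageMeasure P ρ (n k) (liftEvent B)) atTop (𝓝 (μ (liftEvent B))) :=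
    fun hB => by
      simp only [← hν]
      exact (hB.isUniformlyRegular_liftEvent hmarginal).tendsto_measure hνμ
  have herror : Tendsto (fun k => (n k : ℝ≥0∞)⁻¹ * ENNReal.ofReal α₀) atTop (𝓝 0) := by
    simpa using ENNReal.Tendsto.mul_const (ENNReal.tendsto_inv_nat_nhds_zero.comp hn)
      (.inr ENNReal.ofReal_ne_top)
  have hright := ((ENNReal.Tendsto.const_mul (hlim hC') (.inr hc)).add_const ε).add herror
  rw [add_zero] at hright
  exact le_of_tendsto_of_tendsto' (hlim hC) hright fun k =>
    averageMeasure_le_of_forall_ge hρ (measurableSet_liftEvent hC.measurableSet)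
      (measurableSet_liftEvent hC'.measurableSet) h (hn₀ k)

lemma IsApproximable.measure_le {P : Measure (Weights d)} [IsProbabilityMeasure P]
    {ρ : Fin d → ℝ} (hρ : ρ ≠ 0) {μ : Measure (Extended d)} (hμ : IsGeodesicMeasure P ρ μ)
    {e₀ : Edge d} {A : Set (Weights d × GraphConfig d)} (hA : IsApproximable ρ μ e₀ A)
    {W : Set (Weights d)} (hW : MeasurableSet W) {c ε : ℝ≥0∞} (hc : c ≠ ∞)
    (hinc : ∀ B, IncreasingIn e₀ B → MeasurableSet B → P B ≤ c * P (B ∩ W) + ε) :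
    μ (liftEvent A) ≤ c * μ (liftEvent A ∩ Prod.fst ⁻¹' W) + ε := by
  obtain ⟨-, C, hC, hδ, hCinc⟩ := hA
  set δ : ℕ → ℝ≥0∞ := fun n => μ (liftEvent (symmDiff (C n) A))
  have hlim := ((ENNReal.Tendsto.const_mul
    (hδ.const_add (μ (liftEvent A ∩ Prod.fst ⁻¹' W))) (.inr hc)).add_const ε).add hδ
  rw [add_zero, add_zero] at hlim
  refine ge_of_tendsto' hlim fun n => ?_
  obtain ⟨α₀, hα₀⟩ := hCinc n
  have hCW := (hC n).inter_fst_preimage hW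
  have hcylinder : μ (liftEvent (C n)) ≤ c * μ (liftEvent (C n ∩ Prod.fst ⁻¹' W)) + ε :=
    hμ.measure_graphCylinder_le hρ (hC n) hCW hc (α₀ := α₀) fun α hα => by
      have hCm := measurableSet_liftEvent (hC n).measurableSet
      rw [planeMeasure_apply P hρ α hCm,
        planeMeasure_apply P hρ α (measurableSet_liftEvent hCW.measurableSet)]
      exact hinc _ (hα₀ α hα) ((measurable_Phi hρ).comp measurable_prodMk_left hCm)
  have hsymm : ∀ S S' : Set (Extended d), S ⊆ S' ∪ liftEvent (symmDiff (C n) A) →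
      μ S ≤ μ S' + δ n := fun S S' h => (measure_mono h).trans (measure_union_le _ _)
  calc μ (liftEvent A) ≤ μ (liftEvent (C n)) + δ n := hsymm _ _ fun ω hω =>
        (em (ω ∈ liftEvent (C n))).imp_right fun h => Or.inr ⟨hω, h⟩
    _ ≤ c * μ (liftEvent (C n ∩ Prod.fst ⁻¹' W)) + ε + δ n := by gcongr
    _ ≤ c * (μ (liftEvent A ∩ Prod.fst ⁻¹' W) + δ n) + ε + δ n := by
        gcongr
        exact hsymm _ _ fun ω hω => (em (ω ∈ liftEvent A)).imp (⟨·, hω.2⟩)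
          fun h => Or.inl ⟨hω.1, h⟩

/-! ### Conditional probability of a large weight -/

lemma sigmaOff_eq_cylinderEvents (e : Edge d) : sigmaOff e = cylinderEvents {e}ᶜ := by
  rw [sigmaOff, MeasurableSpace.pi, MeasurableSpace.comap_iSup, iSup_subtype]
  simp only [MeasurableSpace.comap_comp]
  rfl

lemma measure_pos_of_lt_supSupport {P : Measure (Weights d)} {e : Edge d} {l : ℝ≥0}
    (hl : (l : ℝ≥0∞) < supSupport P e) : 0 < P {t | l ≤ t e} := by
  simp only [supSupport, lt_iSup_iff] at hl
  obtain ⟨x, hx, hlx⟩ := hl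
  exact hx.trans_le (measure_mono fun t ht => (ENNReal.coe_lt_coe.mp hlx).le.trans ht)

lemma AssumptionA.ae_condExp_pos {P : Measure (Weights d)} [IsFiniteMeasure P]
    (hP : AssumptionA P) {e : Edge d} {l : ℝ≥0} (hl : 0 < P {t | l ≤ t e}) :
    ∀ᵐ t ∂P, 0 < (P⟦{t : Weights d | l ≤ t e} | sigmaOff e⟧) t := by
  have hE : MeasurableSet {t : Weights d | l ≤ t e} := measurable_pi_apply e measurableSet_Ici
  have hEe : MeasurableSet[MeasurableSpace.comap (fun t : Weights d => t e) inferInstance]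
      {t | l ≤ t e} := ⟨Set.Ici l, measurableSet_Ici, rfl⟩
  have hconst : P⟦{t : Weights d | l ≤ t e} | sigmaOff e⟧ =ᵐ[P] fun _ => P.real {t | l ≤ t e} := by
    rw [sigmaOff_eq_cylinderEvents, ← integral_indicator_one hE]
    exact condExp_indep_eq (measurable_pi_apply e).comap_le cylinderEvents_le_pi
      (stronglyMeasurable_const.indicator hEe) (indep_comap_eval_cylinderEvents_compl hP.indep e)
  filter_upwards [hconst] with t ht
  exact ht ▸ ENNReal.toReal_pos hl.ne' (measure_ne_top _ _)

lemma AssumptionB.ae_condExp_pos {P : Measure (Weights d)} [IsFiniteMeasure P]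
    (hP : AssumptionB P) {e : Edge d} {l : ℝ≥0} (hl : 0 < P {t | l ≤ t e}) :
    ∀ᵐ t ∂P, 0 < (P⟦{t : Weights d | l ≤ t e} | sigmaOff e⟧) t := by
  rcases eq_zero_or_pos l with rfl | hl₀
  · have hle : sigmaOff e ≤ MeasurableSpace.pi :=
      (sigmaOff_eq_cylinderEvents e).trans_le cylinderEvents_le_pi
    simp [condExp_const hle]
  · exact hP.finite_energy e l hl₀ hl

lemma IsSupporting.ne_zero {P : Measure (Weights d)} {ρ : Fin d → ℝ} (hρ : IsSupporting P ρ) :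
    ρ ≠ 0 := by
  rintro rfl
  obtain ⟨⟨z, -, hz⟩, -⟩ := hρ
  simp [hyperplane] at hz

end FPP

open FPP in
theorem theoremA1_general {P : Measure (Weights d)} [IsProbabilityMeasure P] {ρ : Fin d → ℝ}
    (hρ : ρ ≠ 0) {μ : Measure (Extended d)} (hμ : IsGeodesicMeasure P ρ μ) {e₀ : Edge d}
    {l : ℝ≥0} (hpos : ∀ᵐ t ∂P, 0 < (P⟦{t : Weights d | l ≤ t e₀} | sigmaOff e₀⟧) t)
    {r : ℝ} (hr : 0 < r) :
    ∃ s : ℝ, 0 < s ∧ ∀ A : Set (Weights d × GraphConfig d),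
      IsApproximable ρ μ e₀ A → r ≤ μ.real (liftEvent A) →
        s ≤ μ.real (liftEvent A ∩ {ω | l ≤ ω.1 e₀}) := by
  have := hμ.isProb
  have hE : MeasurableSet {t : Weights d | l ≤ t e₀} := measurable_pi_apply e₀ measurableSet_Ici
  rw [sigmaOff_eq_cylinderEvents] at hpos
  obtain ⟨K, hK⟩ := exists_measure_le_mul_measure_inter_add cylinderEvents_le_pi hE hpos
    (ε := ENNReal.ofReal (r / 2)) (by simpa using hr)
  refine ⟨r / 2 / (K + 1), by positivity, fun A hA hrA => ?_⟩
  have hle : μ (liftEvent A) ≤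
      (K + 1) * μ (liftEvent A ∩ {ω | l ≤ ω.1 e₀}) + ENNReal.ofReal (r / 2) :=
    hA.measure_le hρ hμ hE (by finiteness) fun B hBinc hB => hBinc.measure_le hK hB
  have hle_real : μ.real (liftEvent A) ≤
      (K + 1) * μ.real (liftEvent A ∩ {ω | l ≤ ω.1 e₀}) + r / 2 := by
    refine (ENNReal.toReal_mono (by finiteness) hle).trans_eq ?_
    rw [ENNReal.toReal_add (by finiteness) ENNReal.ofReal_ne_top, ENNReal.toReal_mul,
      ENNReal.toReal_add ENNReal.coe_ne_top ENNReal.one_ne_top,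
      ENNReal.toReal_ofReal (by positivity)]
    rfl
  rw [div_le_iff₀' (by positivity)]
  linarith

theorem theoremA1 (d : ℕ) (hd : 2 ≤ d)
    (P : Measure (FPP.Weights d)) [IsProbabilityMeasure P]
    (hP : FPP.AssumptionA P ∨ FPP.AssumptionB P)
    (ρ : Fin d → ℝ) (hρ : FPP.IsSupporting P ρ)
    (μ : Measure (FPP.Extended d)) (hμ : FPP.IsGeodesicMeasure P ρ μ)
    (e₀ : FPP.Edge d) (l : ℝ≥0) (hl : (l : ℝ≥0∞) < FPP.supSupport P e₀)
    (r : ℝ) (hr : 0 < r) :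
    ∃ s : ℝ, 0 < s ∧ ∀ A : Set (FPP.Weights d × FPP.GraphConfig d),
      FPP.IsApproximable ρ μ e₀ A → r ≤ μ.real (FPP.liftEvent A) →
        s ≤ μ.real (FPP.liftEvent A ∩ {ω | l ≤ ω.1 e₀}) := by
  have hpos := FPP.measure_pos_of_lt_supSupport hl
  exact theoremA1_general hρ.ne_zero hμ
    (hP.elim (·.ae_condExp_pos hpos) (·.ae_condExp_pos hpos)) hr
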